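/- **Setting.** Let $n, t$ be natural numbers with $n\ge 3t+1$. Nodes $1,\dots,n$ run in an asynchronous system against an adaptive adversary that may corrupt nodes at any time, at most $t$ in total; corrupted nodes behave arbitrarily, and a node is *honest* if it is never corrupted. Local computation is asynchronous but fair: no event handler stays enabled forever at an honest node. An $(n,k)$ *erasure code* over an alphabet $\mathcal{A}$ consists of maps $\mathrm{Enc}:\mathcal{A}^k\to\mathcal{A}^n$ and $\mathrm{Dec}$ such that, if $(y_1,\dots,y_n)=\mathrm{Enc}(\boldsymbol w)$, then $\mathrm{Dec}(\{y_j\}_{j\in S})=\boldsymbol w$ for every $S\subseteq[1:n]$ with $|S|=k$ (the symbols are given with their positions). Fix an $(n,t+1)$ erasure code. *Reliable broadcast (RBC)* with a given leader satisfies: (Consistency) any two values output by honest nodes are equal; (Validity) if the leader is honest and inputs $v$, then every honest node eventually outputs $v$; (Totality) if one honest node outputs a value, then every honest node eventually outputs a value. *Byzantine agreement (BA)* satisfies: (Termination) if all honest nodes receive inputs, then every honest node eventually outputs a value and terminates; (Consistency) if any honest node outputs $v$, then every honest node eventually outputs $v$; (Validity) if all honest nodes input the same $v$, then every honest node eventually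 outputs $v$. Each instance takes at most one input from, and outputs at most one value at, each honest node; its outputs may be delivered at arbitrary times. **Protocol OciorABA\*.** For each $j\in[1:n]$ there is an RBC instance $\mathrm{RBC}[j]$ with leader Node $j$ and a binary BA instance $\mathrm{ABBA}[j]$. Node $i$ does the following until it terminates. 1. Upon receiving an input $\boldsymbol w_i\in\mathcal{A}^{t+1}$: compute $(y_1^{(i)},\dots,y_n^{(i)})=\mathrm{Enc}(\boldsymbol w_i)$ and pass $y_i^{(i)}$ into $\mathrm{RBC}[i]$. 2. Upon delivery of a symbol $y_j^{(j)}$ from $\mathrm{RBC}[j]$: wait until $y_j^{(i)}$ has been computed; then pass into $\mathrm{ABBA}[j]$ the bit $1$ if $y_j^{(j)}=y_j^{(i)}$ and the bit $0$ otherwise (this has no effect if Node $i$ has already passed an input to $\mathrm{ABBA}[j]$). 3. Upon delivery of outputs from $n-t$ of the ABBA instances: pass $0$ into each ABBA instance that has not yet received an input from Node $i$. 4. Upon delivery of outputs from all $n$ ABBA instances: let $A_1$ be the set of all $j$ such that $\mathrm{ABBA}[j]$ delivered $1$. If $|A_1|<t+1$, output the default value $\bot$ and terminate. Otherwise let $A_1'$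 consist of the $t+1$ smallest elements of $A_1$, wait for the delivery of $y_j^{(j)}$ from $\mathrm{RBC}[j]$ for all $j\in A_1'$, output $\mathrm{Dec}(\{y_j^{(j)}\}_{j\in A_1'})$ and terminate. **Theorem (Consistency).** Let $n\ge 3t+1$. In every execution of OciorABA\* in which each $\mathrm{RBC}[j]$ satisfies the properties of reliable broadcast and each $\mathrm{ABBA}[j]$ satisfies those of Byzantine agreement, if any honest node outputs a value $\boldsymbol w$ (a decoded message or $\bot$), then every honest node eventually outputs $\boldsymbol w$. -/

import Mathlib

namespace OciorABA

/-- An `(n, k)` erasure code over the alphabet `A`: a message of `k` symbols is encoded into `n`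
symbols, and any `k` of the encoded symbols, taken with their positions, determine it. -/
structure ErasureCode (A : Type*) (n k : ℕ) where
  enc : (Fin k → A) → Fin n → A
  dec : (S : Finset (Fin n)) → (S → A) → Fin k → A
  dec_enc : ∀ (w : Fin k → A) (S : Finset (Fin n)), S.card = k →
    dec S (fun j => enc w j) = w

/-! ### The interface of the primitives

An instance of a primitive is seen through what the nodes have passed to it and what it has
delivered at the nodes, up to each time `k`. Here `none` means "nothing so far", and `honest` is
the set of nodes that are never corrupted. -/

/-- The defining properties of reliable broadcast, for an instance with a given leader;
`inp k` is what the leader has input, `out k i` what node `i` has output, up to time `k`. -/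
structure IsReliableBroadcast {n : ℕ} {V : Type*} (honest : Set (Fin n)) (leader : Fin n)
    (inp : ℕ → Option V) (out : ℕ → Fin n → Option V) : Prop where
  consistency : ∀ i ∈ honest, ∀ i' ∈ honest, ∀ (k k' : ℕ) (w w' : V),
    out k i = some w → out k' i' = some w' → w = w'
  validity : leader ∈ honest → ∀ w : V, (∃ k, inp k = some w) →
    ∀ i ∈ honest, ∃ k, out k i = some w
  totality : (∃ i ∈ honest, ∃ k w, out k i = some w) →
    ∀ i ∈ honest, ∃ k w, out k i = some w

/-- Consistency of Byzantine agreement: if any honest node outputs a value, then every honest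
node eventually outputs that value. -/
def BAConsistency {n : ℕ} {V : Type*} (honest : Set (Fin n))
    (out : ℕ → Fin n → Option V) : Prop :=
  ∀ w : V, (∃ i ∈ honest, ∃ k, out k i = some w) → ∀ i ∈ honest, ∃ k, out k i = some w

/-- The defining properties of Byzantine agreement; `inp k i` is what node `i` has input and
`out k i` what node `i` has output, up to time `k`. A node terminates in the instance when it
outputs. -/
structure IsByzantineAgreement {n : ℕ} {V : Type*} (honest : Set (Fin n))
    (inp out : ℕ → Fin n → Option V) : Prop where
  termination : (∀ i ∈ honest, ∃ k w, inp k i = some w) →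
    ∀ i ∈ honest, ∃ k w, out k i = some w
  consistency : BAConsistency honest out
  validity : ∀ w : V, (∀ i ∈ honest, ∃ k, inp k i = some w) →
    ∀ i ∈ honest, ∃ k, out k i = some w

/-! ### The protocol -/

/-- An output of the protocol: the default value `⊥` or a decoded message. -/
inductive Output (M : Type*) where
  | default : Output M
  | message (w : M) : Output M

/-- The `m` smallest elements of `S` (all of `S` if it has fewer than `m` elements). -/
def firstSmallest {n : ℕ} (m : ℕ) (S : Finset (Fin n)) : Finset (Fin n) :=
  S.filter fun j => (S.filter fun j' => j' < j).card < m

/-- The local state of one node `i`.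
* `input`: the message that node `i` has received as its input;
* `symbols`: the encoded symbols of that message;
* `rbcIn`: what node `i` has passed into the broadcast instance `RBC[i]` that it leads;
* `rbcOut j`: what `RBC[j]` has delivered at node `i`;
* `vote j`: the bit that records whether the symbol delivered from `RBC[j]` equals node `i`'s own
  `j`-th symbol (`none`: missing);
* `abbaIn j`: what node `i` has passed into the binary agreement instance `ABBA[j]`;
* `abbaOut j`: what `ABBA[j]` has delivered at node `i`;
* `output`: the output of node `i`; the node terminates when it outputs. -/
structure NodeState (A : Type*) (n t : ℕ) where
  input : Option (Fin (t + 1) → A)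
  symbols : Option (Fin n → A)
  rbcIn : Option A
  rbcOut : Fin n → Option A
  vote : Fin n → Option Bool
  abbaIn : Fin n → Option Bool
  abbaOut : Fin n → Option Bool
  output : Option (Output (Fin (t + 1) → A))

namespace NodeState

variable {A : Type*} {n t : ℕ}

/-- The initial state. -/
def init : NodeState A n t where
  input := none
  symbols := none
  rbcIn := none
  rbcOut := fun _ => none
  vote := fun _ => none
  abbaIn := fun _ => none
  abbaOut := fun _ => none
  output := none

/-- The indices of the `ABBA` instances that have delivered an output. -/
def delivered (s : NodeState A n t) : Finset (Fin n) :=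
  Finset.univ.filter fun j => (s.abbaOut j).isSome = true

/-- The indices of the `ABBA` instances that have delivered `1`. -/
def ones (s : NodeState A n t) : Finset (Fin n) :=
  Finset.univ.filter fun j => s.abbaOut j = some true

end NodeState

/-- The event handlers in the code of a node that react to deliveries. -/
inductive Handler (n : ℕ) where
  | onRBC (j : Fin n) : Handler n
  | onSomeABBA : Handler n
  | onAllABBA : Handler n

/-- `h.Exec code s s'`: a node in the state `s` can execute the handler `h`, and `s'` is the
resulting state. A node that has terminated executes nothing. An instance of `ABBA` keeps only the
first input that a node passes to it.
* `onRBC j`: upon delivery from `RBC[j]`, and once the node's own symbols have been computed,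
  compare the delivered symbol with the own `j`-th symbol, and pass the resulting bit to `ABBA[j]`.
* `onSomeABBA`: upon delivery from `n - t` instances of `ABBA`, pass `0` to every instance that has
  not received an input from this node.
* `onAllABBA`: upon delivery from all `n` instances of `ABBA`, output the default value if fewer
  than `t + 1` of them delivered `1`; otherwise wait for the delivery from `RBC[j]` for the `t + 1`
  smallest `j` such that `ABBA[j]` delivered `1`, and output the message decoded from them. -/
def Handler.Exec {A : Type*} [DecidableEq A] {n t : ℕ} (code : ErasureCode A n (t + 1)) :
    Handler n → NodeState A n t → NodeState A n t → Prop
  | .onRBC j, s, s' =>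
      s.output = none ∧ s.vote j = none ∧
      ∃ (y : Fin n → A) (v : A), s.symbols = some y ∧ s.rbcOut j = some v ∧
        s' = { s with
          vote := Function.update s.vote j (some (decide (v = y j)))
          abbaIn := Function.update s.abbaIn j ((s.abbaIn j).or (some (decide (v = y j)))) }
  | .onSomeABBA, s, s' =>
      s.output = none ∧ n - t ≤ s.delivered.card ∧ (∃ j, s.abbaIn j = none) ∧
        s' = { s with abbaIn := fun j => (s.abbaIn j).or (some false) }
  | .onAllABBA, s, s' =>
      s.output = none ∧ s.delivered = Finset.univ ∧
      ((s.ones.card < t + 1 ∧ s' = { s with output := some .default }) ∨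
       (t + 1 ≤ s.ones.card ∧
        ∃ y : firstSmallest (t + 1) s.ones → A,
          (∀ j : firstSmallest (t + 1) s.ones, s.rbcOut j = some (y j)) ∧
          s' = { s with
            output := some (.message (code.dec (firstSmallest (t + 1) s.ones) y)) }))

/-- A handler is enabled if it can be executed. Executing a handler disables it. -/
def Handler.Enabled {A : Type*} [DecidableEq A] {n t : ℕ} (code : ErasureCode A n (t + 1))
    (h : Handler n) (s : NodeState A n t) : Prop :=
  ∃ s', h.Exec code s s'

/-- The steps of a node `i` that follows the protocol. Each instance of a primitive delivers at
most one output at the node, at an arbitrary time and also after the node has terminated. -/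
inductive NodeStep {A : Type*} [DecidableEq A] {n t : ℕ} (code : ErasureCode A n (t + 1))
    (i : Fin n) : NodeState A n t → NodeState A n t → Prop where
  /-- Upon receiving the input `w`: encode it, and pass the own symbol into `RBC[i]`. -/
  | receiveInput (s : NodeState A n t) (w : Fin (t + 1) → A) :
      s.output = none → s.input = none →
      NodeStep code i s { s with
        input := some w
        symbols := some (code.enc w)
        rbcIn := some (code.enc w i) }
  | rbcDeliver (s : NodeState A n t) (j : Fin n) (v : A) : s.rbcOut j = none →
      NodeStep code i s { s with rbcOut := Function.update s.rbcOut j (some v) }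
  | abbaDeliver (s : NodeState A n t) (j : Fin n) (b : Bool) : s.abbaOut j = none →
      NodeStep code i s { s with abbaOut := Function.update s.abbaOut j (some b) }
  | handle (s s' : NodeState A n t) (h : Handler n) : h.Exec code s s' → NodeStep code i s s'

/-- A global configuration: the states of all nodes and the set of nodes corrupted so far. -/
structure Config (A : Type*) (n t : ℕ) where
  node : Fin n → NodeState A n t
  corrupted : Finset (Fin n)

/-- The steps of the system: nothing happens, an uncorrupted node makes a step of the protocol, a
corrupted node changes its state arbitrarily, or the adversary corrupts one more node. -/
inductive Step {A : Type*} [DecidableEq A] {n t : ℕ} (code : ErasureCode A n (t + 1)) :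
    Config A n t → Config A n t → Prop where
  | idle (c : Config A n t) : Step code c c
  | protocol (c : Config A n t) (i : Fin n) (s : NodeState A n t) : i ∉ c.corrupted →
      NodeStep code i (c.node i) s →
      Step code c { c with node := Function.update c.node i s }
  | byzantine (c : Config A n t) (i : Fin n) (s : NodeState A n t) : i ∈ c.corrupted →
      Step code c { c with node := Function.update c.node i s }
  | corrupt (c : Config A n t) (i : Fin n) :
      Step code c { c with corrupted := insert i c.corrupted }

/-- The nodes that are never corrupted. -/
def honest {A : Type*} {n t : ℕ} (ρ : ℕ → Config A n t) : Set (Fin n) :=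
  {i | ∀ k, i ∉ (ρ k).corrupted}

/-- `ρ` is an execution of the protocol against an adaptive adversary that corrupts at most `t`
nodes in total. Local computation is asynchronous but fair: no handler stays enabled forever
at an honest node. -/
structure IsExecution {A : Type*} [DecidableEq A] {n t : ℕ} (code : ErasureCode A n (t + 1))
    (ρ : ℕ → Config A n t) : Prop where
  init : (ρ 0).node = (fun _ => NodeState.init) ∧ (ρ 0).corrupted = ∅
  step : ∀ k, Step code (ρ k) (ρ (k + 1))
  budget : ∀ k, (ρ k).corrupted.card ≤ t
  fair : ∀ i ∈ honest ρ, ∀ (h : Handler n) (k : ℕ), ∃ k', k ≤ k' ∧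
    ¬ h.Enabled code ((ρ k').node i)

end OciorABA

namespace OciorABA

/-! A node's output is a function of its deliveries alone: the `ABBA` bits select the indices, and
the `RBC` symbols at these indices are decoded. `Determines` expresses that the deliveries suffice,
and `DeliveriesLE` compares deliveries. Once sufficient, they stay so with the same result
(`Determines.mono`, `Determines.unique`). By agreement and totality of the primitives, all
deliveries at one honest node at a given time eventually appear at any other
(`exists_deliveriesLE`), so the other's deliveries determine the same value. Its output handler is
then enabled until it outputs, and fairness forces an output. -/

variable {A : Type*} {n t : ℕ}

/-- Every delivery that has happened in `s` has also happened, with the same value, in `s'`. -/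
def NodeState.DeliveriesLE (s s' : NodeState A n t) : Prop :=
  (∀ j v, s.rbcOut j = some v → s'.rbcOut j = some v) ∧
    ∀ j b, s.abbaOut j = some b → s'.abbaOut j = some b

/-- The deliveries in the state `s` are complete enough to determine the output `w`. -/
def NodeState.Determines (code : ErasureCode A n (t + 1)) (s : NodeState A n t)
    (w : Output (Fin (t + 1) → A)) : Prop :=
  s.delivered = Finset.univ ∧
    ((s.ones.card < t + 1 ∧ w = .default) ∨
      (t + 1 ≤ s.ones.card ∧
        ∃ y : firstSmallest (t + 1) s.ones → A,
          (∀ j : firstSmallest (t + 1) s.ones, s.rbcOut j = some (y j)) ∧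
          w = .message (code.dec (firstSmallest (t + 1) s.ones) y)))

namespace NodeState

theorem DeliveriesLE.refl (s : NodeState A n t) : s.DeliveriesLE s :=
  ⟨fun _ _ h => h, fun _ _ h => h⟩

theorem DeliveriesLE.trans {s₁ s₂ s₃ : NodeState A n t} (h : s₁.DeliveriesLE s₂)
    (h' : s₂.DeliveriesLE s₃) : s₁.DeliveriesLE s₃ :=
  ⟨fun j v e => h'.1 j v (h.1 j v e), fun j b e => h'.2 j b (h.2 j b e)⟩

/-- Since all `ABBA` instances have already delivered, no new bit can arrive: the selected index set
is frozen, and the symbols read there persist. -/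
theorem Determines.mono {code : ErasureCode A n (t + 1)} {s s' : NodeState A n t}
    {w : Output (Fin (t + 1) → A)} (h : s.Determines code w) (hle : s.DeliveriesLE s') :
    s'.Determines code w := by
  have habba : s'.abbaOut = s.abbaOut := by
    funext j
    have hj : j ∈ s.delivered := h.1 ▸ Finset.mem_univ j
    obtain ⟨b, hb⟩ := Option.isSome_iff_exists.1 (Finset.mem_filter.1 hj).2
    rw [hb, hle.2 j b hb]
  have hdel : s'.delivered = s.delivered := by simp only [delivered, habba]
  have hones : s'.ones = s.ones := by simp only [ones, habba]
  unfold Determines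
  rw [hdel, hones]
  refine ⟨h.1, h.2.imp_right ?_⟩
  rintro ⟨hc, y, hy, hw⟩
  exact ⟨hc, y, fun j => hle.1 _ _ (hy j), hw⟩

theorem Determines.unique {code : ErasureCode A n (t + 1)} {s : NodeState A n t}
    {w w' : Output (Fin (t + 1) → A)} (h : s.Determines code w) (h' : s.Determines code w') :
    w = w' := by
  rcases h.2 with ⟨hc, rfl⟩ | ⟨hc, y, hy, rfl⟩ <;>
    rcases h'.2 with ⟨hc', rfl⟩ | ⟨hc', y', hy', rfl⟩
  · rfl
  · omega
  · omega
  · have : y = y' := funext fun j => Option.some.inj ((hy j).symm.trans (hy' j))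
    rw [this]

/-- The link to fairness: apart from the node not having terminated, the guard of `onAllABBA` is
exactly `Determines`. -/
theorem Determines.enabled [DecidableEq A] {code : ErasureCode A n (t + 1)}
    {s : NodeState A n t} {w : Output (Fin (t + 1) → A)} (h : s.Determines code w)
    (hs : s.output = none) : (Handler.onAllABBA : Handler n).Enabled code s := by
  rcases h.2 with ⟨hc, -⟩ | ⟨hc, y, hy, -⟩
  · exact ⟨_, hs, h.1, .inl ⟨hc, rfl⟩⟩
  · exact ⟨_, hs, h.1, .inr ⟨hc, y, hy, rfl⟩⟩

end NodeState

variable [DecidableEq A] {code : ErasureCode A n (t + 1)}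

/-- A delivery fills only an empty slot, and no other step touches the delivery fields. -/
theorem NodeStep.deliveriesLE {i : Fin n} {s s' : NodeState A n t} (h : NodeStep code i s s') :
    s.DeliveriesLE s' := by
  cases h with
  | receiveInput w _ _ => exact .refl s
  | rbcDeliver j v hj =>
    refine ⟨fun j' v' e => ?_, fun _ _ e => e⟩
    have : j' ≠ j := by rintro rfl; simp [hj] at e
    simpa [Function.update_of_ne this] using e
  | abbaDeliver j b hj =>
    refine ⟨fun _ _ e => e, fun j' b' e => ?_⟩
    have : j' ≠ j := by rintro rfl; simp [hj] at e
    simpa [Function.update_of_ne this] using e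
  | handle _ h hex =>
    cases h with
    | onRBC j =>
      obtain ⟨-, -, y, v, -, -, rfl⟩ := hex
      exact .refl s
    | onSomeABBA =>
      obtain ⟨-, -, -, rfl⟩ := hex
      exact .refl s
    | onAllABBA =>
      obtain ⟨-, -, ⟨-, rfl⟩ | ⟨-, y, -, rfl⟩⟩ := hex <;> exact .refl s

theorem NodeStep.output_eq_or_determines {i : Fin n} {s s' : NodeState A n t}
    (h : NodeStep code i s s') :
    s'.output = s.output ∨ ∃ w, s'.output = some w ∧ s.Determines code w := by
  cases h with
  | receiveInput w _ _ => exact .inl rfl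
  | rbcDeliver j v hj => exact .inl rfl
  | abbaDeliver j b hj => exact .inl rfl
  | handle _ h hex =>
    cases h with
    | onRBC j =>
      obtain ⟨-, -, y, v, -, -, rfl⟩ := hex
      exact .inl rfl
    | onSomeABBA =>
      obtain ⟨-, -, -, rfl⟩ := hex
      exact .inl rfl
    | onAllABBA =>
      obtain ⟨-, hd, ⟨hc, rfl⟩ | ⟨hc, y, hy, rfl⟩⟩ := hex
      · exact .inr ⟨_, rfl, hd, .inl ⟨hc, rfl⟩⟩
      · exact .inr ⟨_, rfl, hd, .inr ⟨hc, y, hy, rfl⟩⟩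

theorem Step.node_eq_or_nodeStep {c c' : Config A n t} (h : Step code c c') {i : Fin n}
    (hi : i ∉ c.corrupted) : c'.node i = c.node i ∨ NodeStep code i (c.node i) (c'.node i) := by
  cases h with
  | idle => exact .inl rfl
  | protocol i' s hi' hs =>
    by_cases e : i = i'
    · subst e
      exact .inr (by simpa using hs)
    · exact .inl (Function.update_of_ne e _ _)
  | byzantine i' s hi' =>
    have e : i ≠ i' := by rintro rfl; exact hi hi'
    exact .inl (Function.update_of_ne e _ _)
  | corrupt i' => exact .inl rfl

namespace IsExecution

variable {ρ : ℕ → Config A n t} {i : Fin n}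

theorem deliveriesLE (hρ : IsExecution code ρ) (hi : i ∈ honest ρ) {k k' : ℕ} (hk : k ≤ k') :
    ((ρ k).node i).DeliveriesLE ((ρ k').node i) := by
  induction k', hk using Nat.le_induction with
  | base => exact .refl _
  | succ m _ ih =>
    rcases (hρ.step m).node_eq_or_nodeStep (hi m) with h | h
    · rwa [h]
    · exact ih.trans h.deliveriesLE

/-- Only `onAllABBA` writes an output, under a guard that makes it determined; later deliveries
cannot undo this. -/
theorem determines_of_output (hρ : IsExecution code ρ) (hi : i ∈ honest ρ) (k : ℕ)
    {w : Output (Fin (t + 1) → A)} (hw : ((ρ k).node i).output = some w) :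
    ((ρ k).node i).Determines code w := by
  induction k with
  | zero => simp [hρ.init.1, NodeState.init] at hw
  | succ m ih =>
    have hle := hρ.deliveriesLE hi m.le_succ
    rcases (hρ.step m).node_eq_or_nodeStep (hi m) with h | h
    · rw [h] at hw ⊢
      exact ih hw
    · rcases h.output_eq_or_determines with h | ⟨w', h, hd⟩
      · exact (ih (h ▸ hw)).mono hle
      · obtain rfl : w' = w := Option.some.inj (h.symm.trans hw)
        exact hd.mono hle

/-- Deliveries at an honest node are eventually matched at every other honest node. -/
theorem exists_deliveriesLE (hρ : IsExecution code ρ)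
    (hRBC : ∀ j : Fin n, IsReliableBroadcast (honest ρ) j
      (fun k => ((ρ k).node j).rbcIn) (fun k i => ((ρ k).node i).rbcOut j))
    (hABBA : ∀ j : Fin n, IsByzantineAgreement (honest ρ)
      (fun k i => ((ρ k).node i).abbaIn j) (fun k i => ((ρ k).node i).abbaOut j))
    (hi : i ∈ honest ρ) {i' : Fin n} (hi' : i' ∈ honest ρ) (k : ℕ) :
    ∃ K, ((ρ k).node i).DeliveriesLE ((ρ K).node i') := by
  have hr : ∀ j, ∃ K, ∀ v, ((ρ k).node i).rbcOut j = some v →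
      ((ρ K).node i').rbcOut j = some v := by
    intro j
    by_cases h : ∃ v, ((ρ k).node i).rbcOut j = some v
    · obtain ⟨v, hv⟩ := h
      -- Totality yields only some value; consistency identifies it with the one delivered at `i`.
      obtain ⟨K, v', hK⟩ := (hRBC j).totality ⟨i, hi, k, v, hv⟩ i' hi'
      refine ⟨K, fun u hu => ?_⟩
      rw [(hRBC j).consistency i hi i' hi' k K u v' hu hK]
      exact hK
    · exact ⟨0, fun v hv => (h ⟨v, hv⟩).elim⟩
  have ha : ∀ j, ∃ K, ∀ b, ((ρ k).node i).abbaOut j = some b →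
      ((ρ K).node i').abbaOut j = some b := by
    intro j
    by_cases h : ∃ b, ((ρ k).node i).abbaOut j = some b
    · obtain ⟨b, hb⟩ := h
      obtain ⟨K, hK⟩ := (hABBA j).consistency b ⟨i, hi, k, hb⟩ i' hi'
      exact ⟨K, fun u hu => by rw [← hu, hb]; exact hK⟩
    · exact ⟨0, fun b hb => (h ⟨b, hb⟩).elim⟩
  choose R hR using hr
  choose B hB using ha
  -- There are finitely many instances, so the maximum of their times serves all at once.
  refine ⟨Finset.univ.sup R ⊔ Finset.univ.sup B, fun j v hv => ?_, fun j b hb => ?_⟩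
  · exact (hρ.deliveriesLE hi' ((Finset.le_sup (Finset.mem_univ j)).trans le_sup_left)).1 j v
      (hR j v hv)
  · exact (hρ.deliveriesLE hi' ((Finset.le_sup (Finset.mem_univ j)).trans le_sup_right)).2 j b
      (hB j b hb)

end IsExecution

end OciorABA

theorem mainTheorem8 {A : Type*} [DecidableEq A] (n t : ℕ) (hnt : 3 * t + 1 ≤ n)
    (code : OciorABA.ErasureCode A n (t + 1))
    (ρ : ℕ → OciorABA.Config A n t) (hρ : OciorABA.IsExecution code ρ)
    (hRBC : ∀ j : Fin n, OciorABA.IsReliableBroadcast (OciorABA.honest ρ) j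
      (fun k => ((ρ k).node j).rbcIn) (fun k i => ((ρ k).node i).rbcOut j))
    (hABBA : ∀ j : Fin n, OciorABA.IsByzantineAgreement (OciorABA.honest ρ)
      (fun k i => ((ρ k).node i).abbaIn j) (fun k i => ((ρ k).node i).abbaOut j)) :
    OciorABA.BAConsistency (OciorABA.honest ρ) (fun k i => ((ρ k).node i).output) := by
  rintro w ⟨i, hi, k, hw⟩ i' hi'
  obtain ⟨K, hK⟩ := hρ.exists_deliveriesLE hRBC hABBA hi hi' k
  obtain ⟨K', hKK', hdis⟩ := hρ.fair i' hi' .onAllABBA K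
  have hdet := (hρ.determines_of_output hi k hw).mono (hK.trans (hρ.deliveriesLE hi' hKK'))
  -- At time `K'` the handler is disabled although the deliveries suffice; the only possible reason
  -- is that `i'` has already output.
  obtain ⟨w', hw'⟩ := Option.ne_none_iff_exists'.1 fun hnone => hdis (hdet.enabled hnone)
  refine ⟨K', ?_⟩
  rw [hdet.unique (hρ.determines_of_output hi' K' hw')]
  exact hw'
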